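/- Let $p$ be a prime and let $P$ be a finite non-abelian $p$-group. Let $\mathbb{Q}_n\subseteq\mathbb{C}$ denote the $n$-th cyclotomic field. Two irreducible complex characters $\chi,\psi$ of $P$ are called Galois conjugate if, for some positive multiple $n$ of $|P|$, there is $\sigma\in\mathrm{Gal}(\mathbb{Q}_n/\mathbb{Q})$ with $\sigma(\chi(g))=\psi(g)$ for all $g\in P$. Then the following are equivalent: (i) any two non-linear irreducible complex characters $\chi,\psi$ of $P$ (that is, with $\chi(1)\neq 1\neq\psi(1)$) with $\chi(1)=\psi(1)$ are Galois conjugate; (ii) the center $Z(P)$ is cyclic and the commutator subgroup $P'$ has order $p$. -/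

import Mathlib

/-- `χ : G → ℂ` is an irreducible complex character of `G`: the trace function of an irreducible
representation of `G` on some `ℂ ^ d`. -/
def IsIrrChar {G : Type*} [Group G] (χ : G → ℂ) : Prop :=
  ∃ (d : ℕ) (ρ : Representation ℂ G (Fin d → ℂ)), ρ.IsIrreducible ∧ χ = ρ.character

/-- The `n`-th cyclotomic field `ℚ_n`, as a subfield of `ℂ` (for `n ≠ 0`). -/
noncomputable def cyclotomicSubfield (n : ℕ) : IntermediateField ℚ ℂ :=
  IntermediateField.adjoin ℚ {z : ℂ | z ^ n = 1}

/-- `χ` and `ψ` take values in `ℚ_n`, and some `σ ∈ Gal(ℚ_n / ℚ)` carries `χ` to `ψ`. -/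
def GaloisConjugateIn {G : Type*} (n : ℕ) (χ ψ : G → ℂ) : Prop :=
  ∃ σ : cyclotomicSubfield n ≃ₐ[ℚ] cyclotomicSubfield n,
    ∀ g : G, ∃ x : cyclotomicSubfield n, (x : ℂ) = χ g ∧ (σ x : ℂ) = ψ g

/-- `χ` and `ψ` are Galois conjugate: conjugate under `Gal(ℚ_n / ℚ)` for some positive multiple
`n` of the order of the (finite) group `G`. -/
def GaloisConjugate {G : Type*} [Group G] (χ ψ : G → ℂ) : Prop :=
  ∃ n : ℕ, n ≠ 0 ∧ Nat.card G ∣ n ∧ GaloisConjugateIn n χ ψ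

/-- Any two non-linear irreducible characters of `G` of the same degree are Galois conjugate.
The degree of a character is its value at `1`. -/
def IsGCStarGroup (G : Type*) [Group G] : Prop :=
  ∀ χ ψ : G → ℂ, IsIrrChar χ → IsIrrChar ψ → χ 1 ≠ 1 → ψ 1 ≠ 1 → χ 1 = ψ 1 →
    GaloisConjugate χ ψ

/-!
Suppose `|P'| = p` and `Z(P)` is cyclic. Then `P'` is central and lies in every nontrivial normal
subgroup, so each non-linear irreducible character is faithful. It vanishes outside `Z(P)`, because
there `g` is conjugate to some `g * z` with `z ∈ P'` acting as a nontrivial scalar; hence its degree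
squared is `|P : Z(P)|`, and on `Z(P)` it is a multiple of a faithful linear character. Two faithful
linear characters of a cyclic group are Galois conjugate.

Conversely, twisting by linear characters shows that in a group satisfying (i) the kernels of
non-linear irreducible characters lie in `P'`; if `|P'| = p`, one of them is therefore faithful and
`Z(P)` is cyclic. By induction on `|P|`, proving `|P'| = p` reduces to excluding a central subgroup
`K ≤ P'` of order `p` with `|P' : K| = p`. Take irreducible characters `ψ` with kernel `K` and `χ`
whose kernel does not contain `K`. They are not Galois conjugate, so it suffices that
`ψ(1) = χ(1)`. If `P'` is central, `|P : Z(P)|` is `ψ(1) ^ 2` and `χ(1) ^ 2` up to factors `1` or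
`p`, and the parity of the `p`-adic valuation decides. Otherwise choose `t ∈ P'` not central; its
centralizer `C` has index `p`. The three subgroups lemma gives `[C, C] ≤ K`, whence `ψ(1) = p`; then
`|C : Z(ψ)| = p`, where `Z(ψ)` centralizes `C`, so `C` is abelian and `χ(1) = p` too.
-/

open Module Subgroup
open scoped commutatorElement

theorem isCyclic_quotient_of_ker_le {G R : Type*} [Group G] [Finite G] [CommRing R] [IsDomain R]
    (f : G →* R) (N : Subgroup G) [N.Normal] (hN : f.ker ≤ N) : IsCyclic (G ⧸ N) := by
  have hker : f.toHomUnits.ker ≤ N := fun g hg ↦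
    hN (MonoidHom.mem_ker.2 (congrArg Units.val (MonoidHom.mem_ker.1 hg)))
  have : IsCyclic (G ⧸ f.toHomUnits.ker) :=
    isCyclic_of_injective_ringHom ((Units.coeHom R).comp (QuotientGroup.kerLift f.toHomUnits))
      (Units.val_injective.comp (QuotientGroup.kerLift_injective f.toHomUnits))
  exact isCyclic_of_surjective (QuotientGroup.map _ N (MonoidHom.id G) hker)
    (QuotientGroup.map_surjective_of_surjective _ N _ QuotientGroup.mk_surjective hker)

section Representations

variable {k G H V W : Type*} [Field k] [Group G] [Group H] [AddCommGroup V] [Module k V]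
  [AddCommGroup W] [Module k W]

theorem apply_commutatorElement_eq_one_iff {M : Type*} [Monoid M] (f : G →* M) {a b : G} :
    f ⁅a, b⁆ = 1 ↔ Commute (f a) (f b) := by
  have hab : f a * f b = f ⁅a, b⁆ * (f b * f a) := by
    simp only [← map_mul]
    congr 1
    group
  refine ⟨fun h ↦ by rw [Commute, SemiconjBy, hab, h, one_mul], fun h ↦ ?_⟩
  have hunit : IsUnit (f b * f a) := by rw [← map_mul]; exact (Group.isUnit _).map f
  rw [Commute, SemiconjBy, hab] at h
  exact hunit.mul_eq_right.1 h

theorem isIrreducible_iff_forall_invariant {ρ : Representation k G V} :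
    ρ.IsIrreducible ↔
      Nontrivial V ∧ ∀ W : Submodule k V, (∀ g, ∀ v ∈ W, ρ g v ∈ W) → W = ⊥ ∨ W = ⊤ := by
  constructor
  · intro h
    refine ⟨?_, fun W hW ↦ ?_⟩
    · by_contra hV
      rw [not_nontrivial_iff_subsingleton] at hV
      obtain ⟨a, b, hab⟩ := h.exists_pair_ne
      exact hab (Subrepresentation.toSubmodule_injective (Subsingleton.elim _ _))
    · exact (h.eq_bot_or_eq_top (⟨W, hW⟩ : Subrepresentation ρ)).imp
        (congrArg Subrepresentation.toSubmodule) (congrArg Subrepresentation.toSubmodule)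
  · rintro ⟨_, h⟩
    refine
      { exists_pair_ne := ⟨⊥, ⊤, fun hbt ↦ bot_ne_top (α := Submodule k V)
          (congrArg Subrepresentation.toSubmodule hbt)⟩
        eq_bot_or_eq_top := fun W ↦ (h W.toSubmodule W.apply_mem_toSubmodule).imp
          (fun h ↦ Subrepresentation.toSubmodule_injective h)
          (fun h ↦ Subrepresentation.toSubmodule_injective h) }

theorem nontrivial_of_isIrreducible (ρ : Representation k G V) [h : ρ.IsIrreducible] :
    Nontrivial V :=
  (isIrreducible_iff_forall_invariant.1 h).1

theorem eq_top_of_invariant (ρ : Representation k G V) [h : ρ.IsIrreducible]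
    {W : Submodule k V} (hW : ∀ g, ∀ v ∈ W, ρ g v ∈ W) (hW0 : W ≠ ⊥) : W = ⊤ :=
  ((isIrreducible_iff_forall_invariant.1 h).2 W hW).resolve_left hW0

theorem isIrreducible_congr {ρ : Representation k G V} {σ : Representation k G W}
    [hρ : ρ.IsIrreducible] (e : ρ.Equiv σ) : σ.IsIrreducible := by
  rw [Representation.irreducible_iff_isSimpleModule_asModule] at hρ ⊢
  exact IsSimpleModule.congr (LinearEquiv.ofBijective
    (Representation.IntertwiningMap.equivLinearMapAsModule ρ σ e.toIntertwiningMap)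
    e.toLinearEquiv.bijective).symm

theorem isIrreducible_comp (ρ : Representation k G V) [h : ρ.IsIrreducible] {f : H →* G}
    (hf : Function.Surjective f) :
    Representation.IsIrreducible (ρ.comp f : Representation k H V) := by
  rw [isIrreducible_iff_forall_invariant] at h ⊢
  exact ⟨h.1, fun W hW ↦ h.2 W (hf.forall.2 hW)⟩

/-- The twist of a representation by a linear character. -/
def twist (ρ : Representation k G V) (μ : G →* k) : Representation k G V where
  toFun g := μ g • ρ g
  map_one' := by simp only [map_one, one_smul]
  map_mul' a b := by rw [map_mul, map_mul, smul_mul_smul_comm]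

theorem twist_apply (ρ : Representation k G V) (μ : G →* k) (g : G) :
    twist ρ μ g = μ g • ρ g :=
  rfl

instance isIrreducible_twist (ρ : Representation k G V) [h : ρ.IsIrreducible] (μ : G →* k) :
    (twist ρ μ).IsIrreducible := by
  rw [isIrreducible_iff_forall_invariant] at h ⊢
  refine ⟨h.1, fun W hW ↦ h.2 W fun g v hv ↦ ?_⟩
  exact (W.smul_mem_iff ((Group.isUnit g).map μ).ne_zero).1 (hW g v hv)

/-- The center of a representation `ρ` (written `Z(χ)` in terms of its character): the preimage in
`G` of the center of `G ⧸ ker ρ`. It is expressed by commutators, to avoid the quotient. -/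
def repCenter (ρ : Representation k G V) : Subgroup G :=
  (MonoidHom.ker ρ).upperCentralSeriesStep

theorem mem_repCenter_iff {ρ : Representation k G V} {z : G} :
    z ∈ repCenter ρ ↔ ∀ x, ⁅z, x⁆ ∈ MonoidHom.ker ρ :=
  Iff.rfl

theorem center_le_repCenter (ρ : Representation k G V) : center G ≤ repCenter ρ :=
  fun z hz x ↦ by
    rw [commutatorElement_eq_one_iff_mul_comm.2 (mem_center_iff.1 hz x).symm]
    exact one_mem _

theorem finrank_le_index_of_eigenvector (ρ : Representation k G V)
    [ρ.IsIrreducible] (A : Subgroup G) [A.FiniteIndex] {v : V} (hv : v ≠ 0)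
    (hA : ∀ a ∈ A, ∃ c : k, ρ a v = c • v) : finrank k V ≤ A.index := by
  have : Fintype (G ⧸ A) := Fintype.ofFinite _
  let w : G ⧸ A → V := fun q ↦ ρ q.out v
  have hw (g : G) : ρ g v ∈ Submodule.span k (Set.range w) := by
    obtain ⟨a, ha⟩ := QuotientGroup.mk_out_eq_mul A g
    obtain ⟨c, hc⟩ := hA (a : G)⁻¹ (inv_mem a.2)
    have hg : ρ g v = c • w (g : G ⧸ A) := by
      rw [← map_smul, ← hc, ← Module.End.mul_apply, ← map_mul, ha, mul_inv_cancel_right]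
    exact hg ▸ Submodule.smul_mem _ c (Submodule.subset_span ⟨_, rfl⟩)
  have htop : Submodule.span k (Set.range w) = ⊤ := by
    refine eq_top_of_invariant ρ (fun g u hu ↦ ?_) fun hbot ↦ hv ?_
    · refine Submodule.span_le (p := (Submodule.span k _).comap (ρ g)).2 ?_ hu
      rintro _ ⟨q, rfl⟩
      rw [SetLike.mem_coe, Submodule.mem_comap, ← Module.End.mul_apply, ← map_mul]
      exact hw _
    · simpa only [hbot, map_one, Module.End.one_apply, Submodule.mem_bot] using hw 1
  rw [← finrank_top, ← htop, index_eq_card, Nat.card_eq_fintype_card]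
  exact finrank_range_le_card w

theorem character_twist (ρ : Representation k G V) (μ : G →* k) (g : G) :
    (twist ρ μ).character g = μ g * ρ.character g := by
  rw [Representation.character, twist_apply, map_smul, smul_eq_mul, Representation.character]

variable [FiniteDimensional k V]

theorem character_of_eq_smul_one {ρ : Representation k G V} {g : G} {c : k}
    (h : ρ g = c • (1 : End k V)) : ρ.character g = c * finrank k V := by
  rw [Representation.character, h, map_smul, LinearMap.trace_one, smul_eq_mul]

theorem pow_finrank_eq_one_of_commutatorElement {ρ : Representation k G V} {x y : G} {c : k}
    (h : ρ ⁅x, y⁆ = c • (1 : End k V)) : c ^ finrank k V = 1 := by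
  have hdet : LinearMap.det (ρ ⁅x, y⁆) = c ^ finrank k V := by
    rw [h, LinearMap.det_smul, map_one, mul_one]
  rw [← hdet]
  exact (apply_commutatorElement_eq_one_iff (LinearMap.det.comp ρ)).2 (Commute.all _ _)

theorem commutator_le_ker_of_finrank_eq_one (ρ : Representation k G V)
    (h : finrank k V = 1) : commutator G ≤ MonoidHom.ker ρ := by
  rw [commutator_def, commutator_le]
  intro a _ b _
  obtain ⟨c, hc, -⟩ := LinearMap.existsUnique_eq_smul_id_of_finrank_eq_one h (ρ a)
  refine (apply_commutatorElement_eq_one_iff ρ).2 ?_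
  rw [hc]
  exact (Commute.one_left _).smul_left c

variable [IsAlgClosed k]

theorem exists_eq_smul_one_of_commute (ρ : Representation k G V) [ρ.IsIrreducible] {f : End k V}
    (hf : ∀ g, Commute f (ρ g)) : ∃ c : k, f = c • (1 : End k V) := by
  have hschur : Function.Surjective (algebraMap k (ρ.IntertwiningMap ρ)) :=
    Representation.IsIrreducible.algebraMap_intertwiningMap_bijective_of_isAlgClosed.2
  obtain ⟨c, hc⟩ := hschur ⟨f, fun g ↦ hf g⟩
  exact ⟨c, (congrArg Representation.IntertwiningMap.toLinearMap hc).symm⟩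

theorem exists_eq_smul_one_of_mem_repCenter (ρ : Representation k G V) [ρ.IsIrreducible] {z : G}
    (hz : z ∈ repCenter ρ) : ∃ c : k, ρ z = c • (1 : End k V) :=
  exists_eq_smul_one_of_commute ρ fun g ↦ (apply_commutatorElement_eq_one_iff ρ).1 (hz g)

theorem exists_centralCharacter (ρ : Representation k G V) [ρ.IsIrreducible] :
    ∃ μ : repCenter ρ →* k, ∀ z : repCenter ρ, ρ z = μ z • (1 : End k V) := by
  have := nontrivial_of_isIrreducible ρ
  choose c hc using fun z : repCenter ρ ↦ exists_eq_smul_one_of_mem_repCenter ρ z.2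
  have hinj : Function.Injective fun c : k ↦ c • (1 : End k V) := smul_left_injective k one_ne_zero
  refine ⟨⟨⟨c, hinj ?_⟩, fun a b ↦ hinj ?_⟩, hc⟩
  · simp only [← hc, coe_one, map_one, one_smul]
  · simp only [← hc, coe_mul, map_mul]
    rw [hc a, hc b, smul_mul_smul_comm, one_mul]

/-- The linear character through which the center of an irreducible representation acts. -/
noncomputable def centralCharacter (ρ : Representation k G V) [ρ.IsIrreducible] :
    repCenter ρ →* k :=
  (exists_centralCharacter ρ).choose

theorem apply_eq_centralCharacter_smul_one (ρ : Representation k G V) [ρ.IsIrreducible]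
    (z : repCenter ρ) : ρ z = centralCharacter ρ z • (1 : End k V) :=
  (exists_centralCharacter ρ).choose_spec z

theorem centralCharacter_eq_one_iff (ρ : Representation k G V) [ρ.IsIrreducible]
    {z : repCenter ρ} : centralCharacter ρ z = 1 ↔ ρ z = 1 := by
  have := nontrivial_of_isIrreducible ρ
  rw [apply_eq_centralCharacter_smul_one]
  refine ⟨fun h ↦ by rw [h, one_smul], fun h ↦ ?_⟩
  exact smul_left_injective k (one_ne_zero (α := End k V)) (h.trans (one_smul k _).symm)

theorem isCyclic_repCenter_quotient [Finite G] (ρ : Representation k G V) [ρ.IsIrreducible]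
    (N : Subgroup (repCenter ρ)) [N.Normal] (hN : (MonoidHom.ker ρ).subgroupOf (repCenter ρ) ≤ N) :
    IsCyclic (repCenter ρ ⧸ N) :=
  isCyclic_quotient_of_ker_le (centralCharacter ρ) N fun _ hz ↦
    hN ((centralCharacter_eq_one_iff ρ).1 hz)

theorem exists_common_eigenvector [Nontrivial V] {S : Set (End k V)}
    (hS : ∀ f ∈ S, ∀ g ∈ S, Commute f g) : ∃ v ≠ 0, ∀ f ∈ S, ∃ c : k, f v = c • v := by
  obtain ⟨W, hW⟩ := exists_minimal_of_wellFoundedLT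
    (fun W : Submodule k V ↦ W ≠ ⊥ ∧ ∀ f ∈ S, ∀ v ∈ W, f v ∈ W) ⟨⊤, top_ne_bot, by simp⟩
  obtain ⟨v, hvW, hv⟩ := W.exists_mem_ne_zero_of_ne_bot hW.prop.1
  refine ⟨v, hv, fun f hf ↦ ?_⟩
  have : Nontrivial W := W.nontrivial_iff_ne_bot.2 hW.prop.1
  obtain ⟨c, hc⟩ := End.exists_eigenvalue (f.restrict (hW.prop.2 f hf))
  obtain ⟨⟨w, hwW⟩, hw, hw0⟩ := hc.exists_hasEigenvector
  have hwc : f w = c • w := congrArg Subtype.val (End.mem_eigenspace_iff.1 hw)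
  -- `W` meets the `c`-eigenspace of `f`, hence lies in it by minimality.
  have hle : W ≤ W ⊓ End.eigenspace f c := by
    refine hW.le_of_le ⟨(Submodule.ne_bot_iff _).2 ⟨w, ⟨hwW, End.mem_eigenspace_iff.2 hwc⟩, ?_⟩, ?_⟩
      inf_le_left
    · exact fun h ↦ hw0 (Subtype.ext h)
    · rintro g hg u ⟨hu, huc⟩
      refine ⟨hW.prop.2 g hg u hu, End.mem_eigenspace_iff.2 ?_⟩
      rw [← Module.End.mul_apply, hS f hf g hg, Module.End.mul_apply,
        End.mem_eigenspace_iff.1 huc, map_smul]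
  exact ⟨c, End.mem_eigenspace_iff.1 (hle hvW).2⟩

theorem finrank_le_index (ρ : Representation k G V) [ρ.IsIrreducible] (A : Subgroup G)
    [A.FiniteIndex] (hA : ⁅A, A⁆ ≤ MonoidHom.ker ρ) : finrank k V ≤ A.index := by
  have := nontrivial_of_isIrreducible ρ
  obtain ⟨v, hv, hvA⟩ := exists_common_eigenvector (S := ρ '' A) <| by
    rintro _ ⟨a, ha, rfl⟩ _ ⟨b, hb, rfl⟩
    exact (apply_commutatorElement_eq_one_iff ρ).1 (hA (commutator_mem_commutator ha hb))
  exact finrank_le_index_of_eigenvector ρ A hv fun a ha ↦ hvA _ ⟨a, ha, rfl⟩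

theorem finrank_eq_one_iff_commutator_le_ker (ρ : Representation k G V) [ρ.IsIrreducible] :
    finrank k V = 1 ↔ commutator G ≤ MonoidHom.ker ρ := by
  have := nontrivial_of_isIrreducible ρ
  refine ⟨commutator_le_ker_of_finrank_eq_one ρ, fun h ↦ le_antisymm ?_ finrank_pos⟩
  simpa only [index_top] using finrank_le_index ρ ⊤ h

end Representations

section Characters

variable {k G V : Type*} [Field k] [IsAlgClosed k] [Group G] [AddCommGroup V] [Module k V]
  [FiniteDimensional k V]

theorem character_eq_finrank_iff [CharZero k] (ρ : Representation k G V) [ρ.IsIrreducible] {z : G}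
    (hz : z ∈ repCenter ρ) : ρ.character z = finrank k V ↔ ρ z = 1 := by
  have := nontrivial_of_isIrreducible ρ
  have hd : (finrank k V : k) ≠ 0 := Nat.cast_ne_zero.2 finrank_pos.ne'
  rw [character_of_eq_smul_one (apply_eq_centralCharacter_smul_one ρ ⟨z, hz⟩), mul_eq_right₀ hd]
  exact centralCharacter_eq_one_iff ρ

theorem character_eq_zero_of_notMem_repCenter (ρ : Representation k G V) [ρ.IsIrreducible]
    (hρ : commutator G ≤ repCenter ρ) {g : G} (hg : g ∉ repCenter ρ) : ρ.character g = 0 := by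
  obtain ⟨x, hx⟩ : ∃ x, ⁅g, x⁆ ∉ MonoidHom.ker ρ := by
    simpa only [mem_repCenter_iff, not_forall] using hg
  let z : repCenter ρ := ⟨⁅g, x⁆, hρ (commutator_mem_commutator (mem_top g) (mem_top x))⟩
  have hz : centralCharacter ρ z ≠ 1 := fun h ↦ hx ((centralCharacter_eq_one_iff ρ).1 h)
  -- `g` is `⁅g, x⁆` times a conjugate of `g`, and `⁅g, x⁆` acts by a scalar.
  have hχ : ρ.character g = centralCharacter ρ z * ρ.character g := by
    have hgx : ρ g = centralCharacter ρ z • ρ (x * g * x⁻¹) := by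
      rw [← smul_one_mul, ← apply_eq_centralCharacter_smul_one, ← map_mul]
      congr 1
      simp only [z]
      group
    nth_rw 1 [Representation.character, hgx, map_smul, smul_eq_mul, ← Representation.character,
      ρ.char_conj]
  by_contra h0
  exact hz ((right_eq_mul₀ h0).1 hχ)

theorem finrank_sq_eq_index_repCenter [CharZero k] [Finite G] (ρ : Representation k G V)
    [ρ.IsIrreducible] (hρ : commutator G ≤ repCenter ρ) :
    finrank k V ^ 2 = (repCenter ρ).index := by
  classical
  have := Fintype.ofFinite G
  have hG : (Nat.card G : k) ≠ 0 := Nat.cast_ne_zero.2 Nat.card_pos.ne'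
  have := invertibleOfNonzero hG
  have hterm (g : G) : ρ.character g * ρ.character g⁻¹ =
      if g ∈ repCenter ρ then (finrank k V : k) ^ 2 else 0 := by
    split_ifs with hg
    · have hinv : centralCharacter ρ ⟨g, hg⟩ * centralCharacter ρ ⟨g, hg⟩⁻¹ = 1 := by
        rw [← map_mul, mul_inv_cancel, map_one]
      rw [character_of_eq_smul_one (apply_eq_centralCharacter_smul_one ρ ⟨g, hg⟩),
        character_of_eq_smul_one (g := g⁻¹) (apply_eq_centralCharacter_smul_one ρ ⟨g, hg⟩⁻¹)]
      linear_combination (finrank k V : k) ^ 2 * hinv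
    · rw [character_eq_zero_of_notMem_repCenter ρ hρ hg, zero_mul]
  have hnorm : (Nat.card (repCenter ρ) : k) * (finrank k V : k) ^ 2 = Nat.card G := by
    have h := ρ.char_orthonormal ρ
    rw [if_pos ⟨Representation.Equiv.refl ρ⟩, inv_mul_eq_iff_eq_mul₀ hG, mul_one] at h
    simp only [hterm] at h
    rw [← h, ← Finset.sum_filter, Finset.sum_const, nsmul_eq_mul, Nat.card_eq_fintype_card,
      Fintype.card_subtype]
  refine Nat.eq_of_mul_eq_mul_left (Nat.card_pos (α := repCenter ρ)) ?_
  rw [card_mul_index]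
  exact_mod_cast hnorm

end Characters

section Separation

theorem exists_equiv_fin {k G V : Type*} [Field k] [Group G] [AddCommGroup V] [Module k V]
    [FiniteDimensional k V] (ρ : Representation k G V) :
    ∃ σ : Representation k G (Fin (finrank k V) → k), Nonempty (ρ.Equiv σ) := by
  let e : V ≃ₗ[k] (Fin (finrank k V) → k) := (finBasis k V).equivFun
  refine ⟨(e.conjRingEquiv : End k V →* _).comp ρ, ⟨.mk e fun g ↦ ?_⟩⟩
  ext v
  simp

variable (k : Type*) {G : Type*} [Field k] [Group G] [Finite G]

theorem exists_isIrreducible_apply_ne_one [NeZero (Nat.card G : k)] {g : G} (hg : g ≠ 1) :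
    ∃ (d : ℕ) (ρ : Representation k G (Fin d → k)), ρ.IsIrreducible ∧ ρ g ≠ 1 := by
  let R := MonoidAlgebra k G
  have hx : MonoidAlgebra.of k G g - 1 ≠ 0 := by
    rw [sub_ne_zero, ← map_one (MonoidAlgebra.of k G)]
    exact fun h ↦ hg (MonoidAlgebra.of_injective h)
  -- The group algebra is semisimple, so its Jacobson radical vanishes.
  obtain ⟨M, hM, hgM⟩ : ∃ M : Submodule R R, IsCoatom M ∧ MonoidAlgebra.of k G g - 1 ∉ M := by
    by_contra! hall
    have hmem : MonoidAlgebra.of k G g - 1 ∈ Ring.jacobson R := Submodule.mem_sInf.2 hall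
    rw [IsSemisimpleRing.jacobson_eq_bot] at hmem
    exact hx hmem
  have := isSimpleModule_iff_isCoatom.2 hM
  let ρ := Representation.ofModule' (k := k) (G := G) (R ⧸ M)
  have hsmul (r : R) (v : R ⧸ M) : ρ.asAlgebraHom r v = r • v := by
    have hlift : ρ.asAlgebraHom = Algebra.lsmul k k (R ⧸ M) :=
      (MonoidAlgebra.lift k (End k (R ⧸ M)) G).apply_symm_apply _
    rw [hlift, Algebra.lsmul_coe]
  have hirr : ρ.IsIrreducible := by
    rw [Representation.irreducible_iff_isSimpleModule_asModule]
    exact IsSimpleModule.congr (M := ρ.asModule) (N := R ⧸ M)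
      { ρ.asModuleEquiv with map_smul' := fun r v ↦ hsmul r _ }
  have : FiniteDimensional k (R ⧸ M) :=
    Module.Finite.of_surjective (M.mkQ.restrictScalars k) M.mkQ_surjective
  obtain ⟨σ, ⟨e⟩⟩ := exists_equiv_fin ρ
  refine ⟨_, σ, isIrreducible_congr e, fun hσ ↦ hgM ?_⟩
  have hfix : ρ g (Submodule.Quotient.mk 1) = Submodule.Quotient.mk 1 :=
    e.toLinearEquiv.injective ((e.toIntertwiningMap.isIntertwining _ _ g _).trans (by rw [hσ]; rfl))
  rw [← ρ.asAlgebraHom_of, hsmul, ← Submodule.Quotient.mk_smul, smul_eq_mul, mul_one] at hfix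
  exact (Submodule.Quotient.eq M).1 hfix

theorem exists_isIrreducible_le_ker [NeZero (Nat.card G : k)] {N : Subgroup G} [N.Normal] {g : G}
    (hg : g ∉ N) : ∃ (d : ℕ) (ρ : Representation k G (Fin d → k)),
      ρ.IsIrreducible ∧ N ≤ MonoidHom.ker ρ ∧ ρ g ≠ 1 := by
  have : NeZero (Nat.card (G ⧸ N) : k) := by
    refine ⟨left_ne_zero_of_mul (b := (Nat.card N : k)) ?_⟩
    rw [← Nat.cast_mul, ← card_eq_card_quotient_mul_card_subgroup]
    exact NeZero.ne _
  obtain ⟨d, ρ, _, hρ⟩ := exists_isIrreducible_apply_ne_one k (G := G ⧸ N) (g := g)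
    fun h ↦ hg ((QuotientGroup.eq_one_iff g).1 h)
  refine ⟨d, ρ.comp (QuotientGroup.mk' N), isIrreducible_comp ρ (QuotientGroup.mk'_surjective N),
    fun n hn ↦ ?_, hρ⟩
  have hn' : (n : G ⧸ N) = 1 := (QuotientGroup.eq_one_iff n).2 hn
  exact (congrArg ρ hn').trans (map_one ρ)

theorem exists_isIrreducible_not_commutator_le_ker [NeZero (Nat.card G : k)] {N : Subgroup G}
    [N.Normal] (hN : ¬ commutator G ≤ N) :
    ∃ (d : ℕ) (ρ : Representation k G (Fin d → k)),
      ρ.IsIrreducible ∧ N ≤ MonoidHom.ker ρ ∧ ¬ commutator G ≤ MonoidHom.ker ρ := by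
  obtain ⟨g, hg, hgN⟩ := SetLike.not_le_iff_exists.1 hN
  obtain ⟨d, ρ, hirr, hNρ, hρ⟩ := exists_isIrreducible_le_ker k hgN
  exact ⟨d, ρ, hirr, hNρ, fun h ↦ hρ (h hg)⟩

end Separation

section Faithful

variable {k G V : Type*} [Field k] [Group G] [AddCommGroup V] [Module k V]

theorem repCenter_eq_center {ρ : Representation k G V} (hρ : MonoidHom.ker ρ = ⊥) :
    repCenter ρ = center G := by
  refine le_antisymm (fun z hz ↦ mem_center_iff.2 fun x ↦ ?_) (center_le_repCenter ρ)
  have hzx : ⁅z, x⁆ = 1 := by simpa only [hρ, mem_bot] using hz x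
  exact (commutatorElement_eq_one_iff_mul_comm.1 hzx).symm

theorem centralCharacter_comp_inclusion_injective [FiniteDimensional k V] [IsAlgClosed k]
    (ρ : Representation k G V) [ρ.IsIrreducible] (hρ : MonoidHom.ker ρ = ⊥) :
    Function.Injective ((centralCharacter ρ).comp (inclusion (center_le_repCenter ρ))) := by
  refine (injective_iff_map_eq_one _).2 fun z hz ↦ Subtype.ext ?_
  have hzρ : (z : G) ∈ MonoidHom.ker ρ := (centralCharacter_eq_one_iff ρ).1 hz
  simpa only [hρ, mem_bot, coe_one] using hzρ

end Faithful

section Galois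

theorem isCyclotomicExtension_cyclotomicSubfield (n : ℕ) [NeZero n] :
    IsCyclotomicExtension {n} ℚ (cyclotomicSubfield n) := by
  have h := IntermediateField.isCyclotomicExtension_adjoin_of_exists_isPrimitiveRoot {n} ℚ ℂ
    fun m _ h0 ↦ ⟨_, Complex.isPrimitiveRoot_exp m h0⟩
  have hroots : {z : ℂ | ∃ m ∈ ({n} : Set ℕ), m ≠ 0 ∧ z ^ m = 1} = {z | z ^ n = 1} := by
    ext z
    simp [NeZero.ne n]
  rwa [hroots] at h

theorem exists_algEquiv_cyclotomicSubfield {n m : ℕ} (hn : n ≠ 0) (hm : m ∣ n) {a b : ℂ}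
    (ha : IsPrimitiveRoot a m) (hb : IsPrimitiveRoot b m) :
    ∃ (σ : cyclotomicSubfield n ≃ₐ[ℚ] cyclotomicSubfield n) (x y : cyclotomicSubfield n),
      (x : ℂ) = a ∧ (y : ℂ) = b ∧ σ x = y := by
  have : NeZero n := ⟨hn⟩
  have := isCyclotomicExtension_cyclotomicSubfield n
  have : IsGalois ℚ (cyclotomicSubfield n) := IsCyclotomicExtension.isGalois {n} ℚ _
  have hm0 : 0 < m := Nat.pos_of_dvd_of_pos hm (Nat.pos_of_ne_zero hn)
  have hmem {c : ℂ} (hc : IsPrimitiveRoot c m) : c ∈ cyclotomicSubfield n :=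
    IntermediateField.subset_adjoin ℚ _ ((hc.pow_eq_one_iff_dvd n).2 hm)
  have hprim {c : ℂ} (hc : IsPrimitiveRoot c m) :
      IsPrimitiveRoot (⟨c, hmem hc⟩ : cyclotomicSubfield n) m :=
    .of_map_of_injective (f := (cyclotomicSubfield n).val) hc Subtype.val_injective
  have hconj : IsConjRoot ℚ (⟨b, hmem hb⟩ : cyclotomicSubfield n) ⟨a, hmem ha⟩ := by
    rw [isConjRoot_def, ← Polynomial.cyclotomic_eq_minpoly_rat (hprim ha) hm0,
      ← Polynomial.cyclotomic_eq_minpoly_rat (hprim hb) hm0]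
  obtain ⟨σ, hσ⟩ := isConjRoot_iff_exists_algEquiv.1 hconj
  exact ⟨σ, _, _, rfl, rfl, hσ⟩

theorem exists_algEquiv_of_injective {Z : Type*} [Group Z] [Finite Z] [IsCyclic Z] {μ ν : Z →* ℂ}
    (hμ : Function.Injective μ) (hν : Function.Injective ν) {n : ℕ} (hn : n ≠ 0)
    (hZ : Nat.card Z ∣ n) :
    ∃ σ : cyclotomicSubfield n ≃ₐ[ℚ] cyclotomicSubfield n,
      ∀ z, ∃ x : cyclotomicSubfield n, (x : ℂ) = μ z ∧ (σ x : ℂ) = ν z := by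
  obtain ⟨z, hz⟩ := IsCyclic.exists_monoid_generator (α := Z)
  have hprim {μ : Z →* ℂ} (hμ : Function.Injective μ) : IsPrimitiveRoot (μ z) (orderOf z) :=
    orderOf_injective μ hμ z ▸ IsPrimitiveRoot.orderOf (μ z)
  obtain ⟨σ, x, y, hx, hy, hσ⟩ := exists_algEquiv_cyclotomicSubfield hn
    ((orderOf_dvd_natCard z).trans hZ) (hprim hμ) (hprim hν)
  refine ⟨σ, fun w ↦ ?_⟩
  obtain ⟨i, rfl⟩ := hz w
  refine ⟨x ^ i, ?_, ?_⟩
  · rw [IntermediateField.coe_pow, hx, map_pow]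
  · rw [map_pow, hσ, IntermediateField.coe_pow, hy, map_pow]

theorem galoisConjugate_of_ker_eq_bot {G V W : Type*} [Group G] [Finite G] [IsCyclic (center G)]
    [AddCommGroup V] [Module ℂ V] [FiniteDimensional ℂ V]
    [AddCommGroup W] [Module ℂ W] [FiniteDimensional ℂ W] (hG : commutator G ≤ center G)
    (ρ : Representation ℂ G V) [ρ.IsIrreducible] (τ : Representation ℂ G W) [τ.IsIrreducible]
    (hρ : MonoidHom.ker ρ = ⊥) (hτ : MonoidHom.ker τ = ⊥) :
    GaloisConjugate ρ.character τ.character := by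
  have hρZ := repCenter_eq_center hρ
  have hτZ := repCenter_eq_center hτ
  have hd : finrank ℂ V = finrank ℂ W := by
    rw [← Nat.pow_left_inj two_ne_zero, finrank_sq_eq_index_repCenter ρ (hρZ ▸ hG), hρZ,
      finrank_sq_eq_index_repCenter τ (hτZ ▸ hG), hτZ]
  obtain ⟨σ, hσ⟩ := exists_algEquiv_of_injective (centralCharacter_comp_inclusion_injective ρ hρ)
    (centralCharacter_comp_inclusion_injective τ hτ) (Nat.card_pos (α := G)).ne'
    (card_subgroup_dvd_card _)
  refine ⟨Nat.card G, Nat.card_pos.ne', dvd_rfl, σ, fun g ↦ ?_⟩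
  by_cases hg : g ∈ center G
  · obtain ⟨x, hxρ, hxτ⟩ := hσ ⟨g, hg⟩
    refine ⟨x * (finrank ℂ V : cyclotomicSubfield (Nat.card G)), ?_, ?_⟩
    · rw [character_of_eq_smul_one (apply_eq_centralCharacter_smul_one ρ
        ⟨g, center_le_repCenter ρ hg⟩), IntermediateField.coe_mul, hxρ]
      rfl
    · rw [character_of_eq_smul_one (apply_eq_centralCharacter_smul_one τ
        ⟨g, center_le_repCenter τ hg⟩), map_mul, map_natCast, IntermediateField.coe_mul, hxτ, hd]
      rfl
  · refine ⟨0, ?_, ?_⟩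
    · rw [character_eq_zero_of_notMem_repCenter ρ (hρZ ▸ hG) (hρZ ▸ hg)]
      rfl
    · rw [map_zero, character_eq_zero_of_notMem_repCenter τ (hτZ ▸ hG) (hτZ ▸ hg)]
      rfl

theorem GaloisConjugate.eq_of_eq {G : Type*} [Group G] {χ ψ : G → ℂ} (h : GaloisConjugate χ ψ)
    {g g' : G} (hg : χ g = χ g') : ψ g = ψ g' := by
  obtain ⟨n, -, -, σ, hσ⟩ := h
  obtain ⟨x, hx, hx'⟩ := hσ g
  obtain ⟨y, hy, hy'⟩ := hσ g'
  have hxy : x = y := Subtype.ext (by rw [hx, hy, hg])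
  rw [← hx', ← hy', hxy]

end Galois

section Groups

variable {G : Type*} [Group G]

theorem eq_of_card_eq_of_isCyclic {C : Type*} [Group C] [IsCyclic C] [Finite C]
    {H K : Subgroup C} (h : Nat.card H = Nat.card K) : H = K := by
  let _ : CommGroup C := IsCyclic.commGroup
  have key (L : Subgroup C) : L = (powMonoidHom (Nat.card L)).ker := by
    refine eq_of_le_of_card_ge (fun x hx ↦ ?_) ?_
    · exact congrArg Subtype.val (pow_card_eq_one' (x := (⟨x, hx⟩ : L)))
    · rw [IsCyclic.card_powMonoidHom_ker, Nat.gcd_eq_right (card_subgroup_dvd_card L)]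
  rw [key H, h, ← key K]

theorem le_of_relIndex_prime {H L M : Subgroup G} (hHL : H ≤ L) (hHM : H ≤ M)
    (h : (H.relIndex L).Prime) {t : G} (htL : t ∈ L) (htM : t ∈ M) (htH : t ∉ H) : L ≤ M := by
  rw [← relIndex_mul_relIndex H (M ⊓ L) L (le_inf hHM hHL) inf_le_right, inf_relIndex_right,
    Nat.prime_mul_iff, relIndex_eq_one, relIndex_eq_one] at h
  exact h.elim (·.2) fun h ↦ (htH (h.2 ⟨htM, htL⟩)).elim

theorem le_of_prime_card {H N : Subgroup G} (hH : (Nat.card H).Prime) {t : G} (htH : t ∈ H)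
    (htN : t ∈ N) (ht : t ≠ 1) : H ≤ N :=
  le_of_relIndex_prime bot_le bot_le (by rwa [relIndex_bot_left]) htH htN (mt mem_bot.1 ht)

theorem commutator_eq_bot_of_relIndex_prime {A C : Subgroup G} (hAC : A ≤ C)
    (hA : A ≤ centralizer (C : Set G)) (h : (A.relIndex C).Prime) : ⁅C, C⁆ = ⊥ := by
  rw [commutator_eq_bot_iff_le_centralizer, le_centralizer_iff]
  intro t ht
  by_cases htA : t ∈ A
  · exact hA htA
  have hC : C ≤ centralizer {t} := by
    refine le_of_relIndex_prime hAC (fun a ha ↦ ?_) h ht (mem_centralizer_singleton_iff.2 rfl) htA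
    exact mem_centralizer_singleton_iff.2 (mem_centralizer_iff.1 (hA ha) t ht).symm
  exact fun c hc ↦ mem_centralizer_singleton_iff.1 (hC hc)

theorem normal_of_le_center {K : Subgroup G} (hK : K ≤ center G) : K.Normal :=
  ⟨fun z hz x ↦ by rwa [mem_center_iff.1 (hK hz) x, mul_inv_cancel_right]⟩

theorem commutatorElement_mul_left_of_mem_center {x y t : G} (h : ⁅y, t⁆ ∈ center G) :
    ⁅x * y, t⁆ = ⁅x, t⁆ * ⁅y, t⁆ := by
  rw [commutatorElement_mul_left_eq_conj_mul, mem_center_iff.1 h x, mul_inv_cancel_right,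
    mem_center_iff.1 h]

theorem commutatorElement_pow_left_of_mem_center {w x : G} (h : ⁅w, x⁆ ∈ center G) (n : ℕ) :
    ⁅w ^ n, x⁆ = ⁅w, x⁆ ^ n := by
  induction n with
  | zero => rw [pow_zero, pow_zero, commutatorElement_one_left]
  | succ n ih => rw [pow_succ, commutatorElement_mul_left_of_mem_center h, ih, pow_succ]

theorem index_centralizer_dvd_card {K : Subgroup G} (hK : K ≤ center G) {t : G}
    (ht : ∀ x : G, ⁅x, t⁆ ∈ K) : (centralizer {t}).index ∣ Nat.card K := by
  let f : G →* K := MonoidHom.mk' (fun x ↦ ⟨⁅x, t⁆, ht x⟩) fun x y ↦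
    Subtype.ext (commutatorElement_mul_left_of_mem_center (hK (ht y)))
  have hf : f.ker = centralizer {t} := by
    ext x
    rw [MonoidHom.mem_ker, mem_centralizer_singleton_iff, ← commutatorElement_eq_one_iff_mul_comm]
    exact Subtype.ext_iff
  rw [← hf, index_ker]
  exact card_subgroup_dvd_card _

theorem index_centralizer_eq_card {K : Subgroup G} (hK : K ≤ center G) (hp : (Nat.card K).Prime)
    {t : G} (ht : ∀ x : G, ⁅x, t⁆ ∈ K) (htZ : t ∉ center G) :
    (centralizer {t}).index = Nat.card K := by
  refine ((Nat.dvd_prime hp).1 (index_centralizer_dvd_card hK ht)).resolve_left fun h ↦ htZ ?_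
  refine mem_center_iff.2 fun x ↦ mem_centralizer_singleton_iff.1 ?_
  rw [index_eq_one.1 h]
  exact mem_top x

theorem card_commutator_quotient (K : Subgroup G) [K.Normal] :
    Nat.card (commutator (G ⧸ K)) = K.relIndex (commutator G) := by
  rw [commutator_def, commutator_def, ← map_top_of_surjective _ (QuotientGroup.mk'_surjective K),
    ← map_commutator, ← relIndex_ker, QuotientGroup.ker_mk']

theorem exists_monoidHom_apply_ne_one [Finite G] (k : Type*) [Field k] [IsAlgClosed k] [CharZero k]
    {g : G} (hg : g ∉ commutator G) : ∃ ν : G →* k, ν g ≠ 1 := by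
  have hg' : Abelianization.of g ≠ 1 := fun h ↦ hg ((QuotientGroup.eq_one_iff g).1 h)
  have : NeZero (Monoid.exponent (Abelianization G) : k) :=
    ⟨Nat.cast_ne_zero.2 Monoid.exponent_ne_zero_of_finite⟩
  obtain ⟨φ, hφ⟩ := CommGroup.exists_apply_ne_one_of_hasEnoughRootsOfUnity (Abelianization G) k hg'
  exact ⟨((Units.coeHom k).comp φ).comp Abelianization.of, fun h ↦ hφ (Units.ext h)⟩

end Groups

section PGroups

variable {p : ℕ} [Fact p.Prime] {G : Type*} [Group G] [Finite G]

theorem exists_le_inf_center_card_eq (hG : IsPGroup p G) {N : Subgroup G} [N.Normal]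
    (hN : N ≠ ⊥) : ∃ K ≤ N ⊓ center G, Nat.card K = p := by
  have hdvd : p ∣ Nat.card N :=
    (hG.to_subgroup N).card_eq_or_dvd.resolve_left fun h ↦ hN (N.card_eq_one.1 h)
  obtain ⟨b, hb, hb1⟩ :=
    (hG.of_equiv ConjAct.toConjAct).exists_fixed_point_of_prime_dvd_card_of_fixed_point N hdvd
      (a := 1) fun g ↦ smul_one g
  have hbZ : (b : G) ∈ center G := mem_center_iff.2 fun g ↦ by
    have h := congrArg Subtype.val (hb (ConjAct.toConjAct g))
    rw [ConjAct.Subgroup.val_conj_smul, ConjAct.toConjAct_smul] at h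
    exact mul_inv_eq_iff_eq_mul.1 h
  have hne : N ⊓ center G ≠ ⊥ := fun h ↦
    hb1 (Subtype.ext (mem_bot.1 (h ▸ mem_inf.2 ⟨b.2, hbZ⟩)).symm)
  have hdvd' : p ∣ Nat.card (N ⊓ center G : Subgroup G) :=
    (hG.to_subgroup _).card_eq_or_dvd.resolve_left fun h ↦ hne (card_eq_one.1 h)
  obtain ⟨z, hz⟩ := exists_prime_orderOf_dvd_card' p hdvd'
  refine ⟨zpowers (z : G), zpowers_le.2 z.2, ?_⟩
  rw [Nat.card_zpowers, orderOf_coe, hz]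

theorem le_center_of_card_eq (hG : IsPGroup p G) {N : Subgroup G} [N.Normal]
    (hN : Nat.card N = p) : N ≤ center G := by
  have hbot : N ≠ ⊥ := fun h ↦ (Fact.out : p.Prime).ne_one (by rw [← hN, h, card_bot])
  obtain ⟨K, hK, hKp⟩ := exists_le_inf_center_card_eq hG hbot
  rw [← eq_of_le_of_card_ge (hK.trans inf_le_left) (hN.trans hKp.symm).le]
  exact hK.trans inf_le_right

theorem le_of_isCyclic_center (hG : IsPGroup p G) [IsCyclic (center G)] {H N : Subgroup G}
    [N.Normal] (hHZ : H ≤ center G) (hH : Nat.card H = p) (hN : N ≠ ⊥) : H ≤ N := by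
  obtain ⟨K, hK, hKp⟩ := exists_le_inf_center_card_eq hG hN
  have hKZ := hK.trans inf_le_right
  have hHK : H.subgroupOf (center G) = K.subgroupOf (center G) := by
    refine eq_of_card_eq_of_isCyclic (C := center G) ?_
    rw [Nat.card_congr (subgroupOfEquivOfLe hHZ).toEquiv,
      Nat.card_congr (subgroupOfEquivOfLe hKZ).toEquiv, hH, hKp]
  rw [subgroupOf_inj, inf_eq_left.2 hHZ, inf_eq_left.2 hKZ] at hHK
  exact hHK ▸ hK.trans inf_le_left

end PGroups

section Degrees

theorem eq_of_mul_sq_eq_mul_sq {p r s d e : ℕ} (hp : p.Prime) (hr : r ∣ p) (hs : s ∣ p)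
    (h : r * d ^ 2 = s * e ^ 2) : d = e := by
  have : Fact p.Prime := ⟨hp⟩
  have key {a b : ℕ} (hab : a ^ 2 = p * b ^ 2) : a = b := by
    rcases eq_or_ne b 0 with rfl | hb
    · simpa using hab
    · have hval := congrArg (padicValNat p) hab
      rw [padicValNat.mul hp.ne_zero (pow_ne_zero 2 hb), padicValNat.pow, padicValNat.pow,
        padicValNat_self] at hval
      omega
  rcases (Nat.dvd_prime hp).1 hr with rfl | rfl <;> rcases (Nat.dvd_prime hp).1 hs with rfl | rfl
  · exact Nat.pow_left_injective two_ne_zero (by simpa only [one_mul] using h)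
  · exact key (by simpa only [one_mul] using h)
  · exact (key (by simpa only [one_mul] using h.symm)).symm
  · exact Nat.pow_left_injective two_ne_zero (Nat.eq_of_mul_eq_mul_left hp.pos h)

variable {k G V W : Type*} [Field k] [IsAlgClosed k] [Group G]
  [AddCommGroup V] [Module k V] [FiniteDimensional k V]
  [AddCommGroup W] [Module k W] [FiniteDimensional k W]

theorem dvd_finrank_of_commutatorElement {p : ℕ} [hp : Fact p.Prime] (hG : IsPGroup p G)
    (ρ : Representation k G V) [ρ.IsIrreducible] {x y : G} (hxy : ⁅x, y⁆ ∈ repCenter ρ)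
    (h : ρ ⁅x, y⁆ ≠ 1) : p ∣ finrank k V := by
  set z : repCenter ρ := ⟨⁅x, y⁆, hxy⟩
  obtain ⟨n, hn⟩ := hG.to_subgroup (repCenter ρ) z
  have hpow : centralCharacter ρ z ^ p ^ n = 1 := by rw [← map_pow, hn, map_one]
  have hrank : centralCharacter ρ z ^ finrank k V = 1 :=
    pow_finrank_eq_one_of_commutatorElement (apply_eq_centralCharacter_smul_one ρ z)
  by_contra hdvd
  have hcop : (p ^ n).Coprime (finrank k V) := (hp.out.coprime_iff_not_dvd.2 hdvd).pow_left n
  refine h ((centralCharacter_eq_one_iff ρ (z := z)).1 (orderOf_eq_one_iff.1 ?_))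
  exact Nat.eq_one_of_dvd_coprimes hcop (orderOf_dvd_of_pow_eq_one hpow)
    (orderOf_dvd_of_pow_eq_one hrank)

variable [Finite G]

theorem relIndex_center_repCenter_dvd (ρ : Representation k G V) [ρ.IsIrreducible]
    (hρ : MonoidHom.ker ρ ≤ center G) :
    (center G).relIndex (repCenter ρ) ∣ Nat.card (MonoidHom.ker ρ) := by
  have := isCyclic_repCenter_quotient ρ ((center G).subgroupOf (repCenter ρ)) fun _ hz ↦ hρ hz
  rw [relIndex, index_eq_card, ← IsCyclic.exponent_eq_card]
  refine Monoid.exponent_dvd_of_forall_pow_eq_one fun q ↦ ?_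
  obtain ⟨w, rfl⟩ := QuotientGroup.mk_surjective q
  refine (QuotientGroup.eq_one_iff _).2 (mem_center_iff.2 fun x ↦ ?_)
  have hpow : ⁅(w : G) ^ Nat.card (MonoidHom.ker ρ), x⁆ = 1 := by
    rw [commutatorElement_pow_left_of_mem_center (hρ (w.2 x))]
    exact congrArg Subtype.val (pow_card_eq_one' (x := (⟨_, w.2 x⟩ : MonoidHom.ker ρ)))
  exact (commutatorElement_eq_one_iff_mul_comm.1 hpow).symm

theorem finrank_eq_of_commutator_le_center [CharZero k] {p : ℕ} (hp : p.Prime)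
    (hG : commutator G ≤ center G) (ρ : Representation k G V) [ρ.IsIrreducible]
    (τ : Representation k G W) [τ.IsIrreducible]
    (hρ : MonoidHom.ker ρ ≤ center G) (hρp : Nat.card (MonoidHom.ker ρ) ∣ p)
    (hτ : MonoidHom.ker τ ≤ center G) (hτp : Nat.card (MonoidHom.ker τ) ∣ p) :
    finrank k V = finrank k W := by
  refine eq_of_mul_sq_eq_mul_sq hp ((relIndex_center_repCenter_dvd ρ hρ).trans hρp)
    ((relIndex_center_repCenter_dvd τ hτ).trans hτp) ?_
  rw [finrank_sq_eq_index_repCenter ρ (hG.trans (center_le_repCenter ρ)),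
    finrank_sq_eq_index_repCenter τ (hG.trans (center_le_repCenter τ)),
    relIndex_mul_index (center_le_repCenter ρ), relIndex_mul_index (center_le_repCenter τ)]

end Degrees

section DegreesOfPGroups

variable {p : ℕ} [hp : Fact p.Prime] {k G V W : Type*} [Field k] [Group G] [Finite G]
  [AddCommGroup V] [Module k V] [AddCommGroup W] [Module k W]

theorem commutator_le_repCenter (hG : IsPGroup p G) (ρ : Representation k G V)
    (hρ : (MonoidHom.ker ρ).relIndex (commutator G) = p) : commutator G ≤ repCenter ρ := by
  have hcard := (card_commutator_quotient (MonoidHom.ker ρ)).trans hρ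
  have hZ := le_center_of_card_eq (hG.to_quotient _) hcard
  intro z hz x
  have hz' : (z : G ⧸ MonoidHom.ker ρ) ∈ commutator (G ⧸ MonoidHom.ker ρ) := by
    rw [commutator_def, ← map_top_of_surjective _ (QuotientGroup.mk'_surjective _),
      ← map_commutator]
    exact mem_map_of_mem _ hz
  exact (QuotientGroup.eq_one_iff ⁅z, x⁆).1
    (commutatorElement_eq_one_iff_mul_comm.2 (mem_center_iff.1 (hZ hz') x).symm)

theorem index_centralizer_eq (hG : IsPGroup p G) (ρ : Representation k G V)
    (hker : Nat.card (MonoidHom.ker ρ) = p)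
    (hcomm : (MonoidHom.ker ρ).relIndex (commutator G) = p) {t : G} (ht : t ∈ commutator G)
    (htZ : t ∉ center G) : (centralizer {t}).index = p := by
  rw [← hker]
  refine index_centralizer_eq_card (le_center_of_card_eq hG hker) (hker ▸ hp.out) (fun x ↦ ?_) htZ
  rw [← commutatorElement_inv]
  exact inv_mem (commutator_le_repCenter hG ρ hcomm ht x)

variable [IsAlgClosed k] [FiniteDimensional k V]

theorem repCenter_le_centralizer_centralizer (hG : IsPGroup p G) (ρ : Representation k G V)
    [ρ.IsIrreducible] (hker : Nat.card (MonoidHom.ker ρ) = p)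
    (hcomm : (MonoidHom.ker ρ).relIndex (commutator G) = p) {t : G} (ht : t ∈ commutator G)
    (htZ : t ∉ center G) : repCenter ρ ≤ centralizer (centralizer {t} : Set G) := by
  have htρ : t ∈ repCenter ρ := commutator_le_repCenter hG ρ hcomm ht
  have hindex : (center G).relIndex (repCenter ρ) = p :=
    ((Nat.dvd_prime hp.out).1 (hker ▸ relIndex_center_repCenter_dvd ρ
      (le_center_of_card_eq hG hker))).resolve_left fun h ↦ htZ (relIndex_eq_one.1 h htρ)
  refine le_of_relIndex_prime (center_le_repCenter ρ) (center_le_centralizer _)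
    (hindex ▸ hp.out) htρ (fun c hc ↦ ?_) htZ
  exact mem_centralizer_singleton_iff.1 hc

theorem commutator_centralizer_le_ker (hG : IsPGroup p G) (ρ : Representation k G V)
    [ρ.IsIrreducible] (hker : Nat.card (MonoidHom.ker ρ) = p)
    (hcomm : (MonoidHom.ker ρ).relIndex (commutator G) = p) {t : G} (ht : t ∈ commutator G)
    (htZ : t ∉ center G) (hle : MonoidHom.ker ρ ≤ commutator G) :
    ⁅centralizer {t}, centralizer {t}⁆ ≤ MonoidHom.ker ρ := by
  set C := centralizer {t}
  have hCC : ⁅C, C⁆ ≤ commutator G := commutator_mono le_top le_top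
  -- The three subgroups lemma for `C`, `⊤`, `C`.
  have hrot : ⁅⁅C, (⊤ : Subgroup G)⁆, C⁆ = ⊥ := by
    rw [commutator_eq_bot_iff_le_centralizer]
    exact (commutator_mono le_top le_rfl).trans <| (commutator_le_repCenter hG ρ hcomm).trans <|
      repCenter_le_centralizer_centralizer hG ρ hker hcomm ht htZ
  have hCZ : ⁅C, C⁆ ≤ center G := by
    rw [← centralizer_univ, ← coe_top, ← commutator_eq_bot_iff_le_centralizer]
    exact commutator_commutator_eq_bot_of_rotate hrot (commutator_comm C ⊤ ▸ hrot)
  intro c hc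
  by_contra hcρ
  exact htZ (le_of_relIndex_prime hle (le_center_of_card_eq hG hker) (hcomm ▸ hp.out) (hCC hc)
    (hCZ hc) hcρ ht)

theorem finrank_eq_of_card_ker_eq (hG : IsPGroup p G) (ρ : Representation k G V)
    [ρ.IsIrreducible] (hker : Nat.card (MonoidHom.ker ρ) = p)
    (hcomm : (MonoidHom.ker ρ).relIndex (commutator G) = p) {t : G} (ht : t ∈ commutator G)
    (htZ : t ∉ center G) (hle : MonoidHom.ker ρ ≤ commutator G) : finrank k V = p := by
  have := nontrivial_of_isIrreducible ρ
  have hZ := commutator_le_repCenter hG ρ hcomm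
  obtain ⟨x, y, hxy⟩ : ∃ x y : G, ρ ⁅x, y⁆ ≠ 1 := by
    by_contra! h
    have hGρ : commutator G ≤ MonoidHom.ker ρ := commutator_le.2 fun x _ y _ ↦ h x y
    exact hp.out.ne_one (hcomm.symm.trans (relIndex_eq_one.2 hGρ))
  refine le_antisymm ?_ (Nat.le_of_dvd finrank_pos (dvd_finrank_of_commutatorElement hG ρ
    (hZ (commutator_mem_commutator (mem_top x) (mem_top y))) hxy))
  rw [← index_centralizer_eq hG ρ hker hcomm ht htZ]
  exact finrank_le_index ρ _ (commutator_centralizer_le_ker hG ρ hker hcomm ht htZ hle)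

theorem commutator_centralizer_eq_bot [CharZero k] (hG : IsPGroup p G) (ρ : Representation k G V)
    [ρ.IsIrreducible] (hker : Nat.card (MonoidHom.ker ρ) = p)
    (hcomm : (MonoidHom.ker ρ).relIndex (commutator G) = p) {t : G} (ht : t ∈ commutator G)
    (htZ : t ∉ center G) (hle : MonoidHom.ker ρ ≤ commutator G) :
    ⁅centralizer {t}, centralizer {t}⁆ = ⊥ := by
  have hρC := repCenter_le_centralizer_centralizer hG ρ hker hcomm ht htZ
  have hle' : repCenter ρ ≤ centralizer {t} := fun z hz ↦
    mem_centralizer_singleton_iff.2 (hρC hz t (mem_centralizer_singleton_iff.2 rfl)).symm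
  have hindex : (repCenter ρ).relIndex (centralizer {t}) = p := by
    have h := relIndex_mul_index hle'
    rw [← finrank_sq_eq_index_repCenter ρ (commutator_le_repCenter hG ρ hcomm),
      index_centralizer_eq hG ρ hker hcomm ht htZ,
      finrank_eq_of_card_ker_eq hG ρ hker hcomm ht htZ hle, sq] at h
    exact Nat.eq_of_mul_eq_mul_right hp.out.pos h
  exact commutator_eq_bot_of_relIndex_prime hle' hρC (hindex ▸ hp.out)

theorem finrank_eq_of_not_ker_le_ker [CharZero k] [FiniteDimensional k W] (hG : IsPGroup p G)
    (ρ : Representation k G V) [ρ.IsIrreducible] (hker : Nat.card (MonoidHom.ker ρ) = p)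
    (hcomm : (MonoidHom.ker ρ).relIndex (commutator G) = p) {t : G} (ht : t ∈ commutator G)
    (htZ : t ∉ center G) (hle : MonoidHom.ker ρ ≤ commutator G)
    (τ : Representation k G W) [τ.IsIrreducible]
    (hτ : ¬ MonoidHom.ker ρ ≤ MonoidHom.ker τ) : finrank k W = p := by
  have := nontrivial_of_isIrreducible τ
  refine le_antisymm ?_ (Nat.le_of_dvd finrank_pos ?_)
  · rw [← index_centralizer_eq hG ρ hker hcomm ht htZ]
    refine finrank_le_index τ _ ?_
    rw [commutator_centralizer_eq_bot hG ρ hker hcomm ht htZ hle]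
    exact bot_le
  · obtain ⟨x, hx⟩ : ∃ x : G, ⁅t, x⁆ ≠ 1 := by
      by_contra! h
      exact htZ (mem_center_iff.2 fun x ↦ (commutatorElement_eq_one_iff_mul_comm.1 (h x)).symm)
    have hxρ : ⁅t, x⁆ ∈ MonoidHom.ker ρ := commutator_le_repCenter hG ρ hcomm ht x
    refine dvd_finrank_of_commutatorElement hG τ
      (center_le_repCenter τ (le_center_of_card_eq hG hker hxρ)) fun hxτ ↦
        hτ (le_of_prime_card (hker ▸ hp.out) hxρ hxτ hx)

end DegreesOfPGroups

section KernelsOfPGroups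

variable {p : ℕ} [hp : Fact p.Prime] {k G V W : Type*} [Field k] [IsAlgClosed k] [Group G]
  [Finite G] [AddCommGroup V] [Module k V] [FiniteDimensional k V] [AddCommGroup W] [Module k W]
  [FiniteDimensional k W]

theorem ker_eq_bot_of_finrank_ne_one (hG : IsPGroup p G) [IsCyclic (center G)]
    (hc : Nat.card (commutator G) = p) (ρ : Representation k G V) [ρ.IsIrreducible]
    (hρ : finrank k V ≠ 1) : MonoidHom.ker ρ = ⊥ := by
  by_contra hker
  exact hρ ((finrank_eq_one_iff_commutator_le_ker ρ).2
    (le_of_isCyclic_center hG (le_center_of_card_eq hG hc) hc hker))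

theorem finrank_eq_finrank_of_not_ker_le_ker [CharZero k] (hG : IsPGroup p G)
    (ρ : Representation k G V) [ρ.IsIrreducible] (τ : Representation k G W) [τ.IsIrreducible]
    (hker : Nat.card (MonoidHom.ker ρ) = p) (hcomm : (MonoidHom.ker ρ).relIndex (commutator G) = p)
    (hρ : MonoidHom.ker ρ ≤ commutator G) (hτ : MonoidHom.ker τ ≤ commutator G)
    (hρτ : ¬ MonoidHom.ker ρ ≤ MonoidHom.ker τ) : finrank k V = finrank k W := by
  by_cases hGZ : commutator G ≤ center G
  · refine finrank_eq_of_commutator_le_center hp.out hGZ ρ τ (hρ.trans hGZ) hker.dvd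
      (hτ.trans hGZ) ?_
    have hcard : Nat.card (commutator G) = p ^ 2 := by
      rw [← relIndex_bot_left, ← relIndex_mul_relIndex ⊥ _ _ bot_le hρ, relIndex_bot_left, hker,
        hcomm, sq]
    obtain ⟨i, hi, hτi⟩ := (Nat.dvd_prime_pow hp.out).1 (hcard ▸ card_dvd_of_le hτ)
    have hi2 : i ≠ 2 := by
      rintro rfl
      exact hρτ (eq_of_le_of_card_ge hτ (hcard.trans hτi.symm).le ▸ hρ)
    rw [hτi]
    exact (pow_dvd_pow p (show i ≤ 1 by omega)).trans (pow_one p).dvd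
  · obtain ⟨t, ht, htZ⟩ := SetLike.not_le_iff_exists.1 hGZ
    rw [finrank_eq_of_card_ker_eq hG ρ hker hcomm ht htZ hρ,
      finrank_eq_of_not_ker_le_ker hG ρ hker hcomm ht htZ hρ τ hρτ]

end KernelsOfPGroups

section GCStar

variable {G V W : Type*} [Group G] [AddCommGroup V] [Module ℂ V] [FiniteDimensional ℂ V]
  [AddCommGroup W] [Module ℂ W] [FiniteDimensional ℂ W]

theorem isIrrChar_character (ρ : Representation ℂ G V) [ρ.IsIrreducible] :
    IsIrrChar ρ.character := by
  obtain ⟨σ, ⟨e⟩⟩ := exists_equiv_fin ρ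
  exact ⟨_, σ, isIrreducible_congr e, Representation.char_iso e⟩

theorem IsGCStarGroup.of_surjective {H : Type*} [Group H] (h : IsGCStarGroup G) {f : G →* H}
    (hf : Function.Surjective f) : IsGCStarGroup H := by
  rintro _ _ ⟨d, ρ, _, rfl⟩ ⟨e, τ, _, rfl⟩ hd he hde
  have hone {m : ℕ} (ρ : Representation ℂ H (Fin m → ℂ)) :
      Representation.character (ρ.comp f : Representation ℂ G (Fin m → ℂ)) 1 = ρ.character 1 := by
    rw [Representation.char_one, Representation.char_one]
  obtain ⟨n, hn, hcard, σ, hσ⟩ := h _ _ ⟨d, ρ.comp f, isIrreducible_comp ρ hf, rfl⟩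
    ⟨e, τ.comp f, isIrreducible_comp τ hf, rfl⟩ (by rwa [hone]) (by rwa [hone])
    (by rwa [hone, hone])
  exact ⟨n, hn, (card_dvd_of_surjective f hf).trans hcard, σ, hf.forall.2 hσ⟩

theorem IsGCStarGroup.galoisConjugate (h : IsGCStarGroup G) (ρ : Representation ℂ G V)
    [ρ.IsIrreducible] (τ : Representation ℂ G W) [τ.IsIrreducible] (hρ : finrank ℂ V ≠ 1)
    (hτ : finrank ℂ V = finrank ℂ W) : GaloisConjugate ρ.character τ.character := by
  refine h _ _ (isIrrChar_character ρ) (isIrrChar_character τ) ?_ ?_ ?_ <;>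
    simp only [Representation.char_one, ← hτ]
  all_goals exact_mod_cast hρ

theorem IsGCStarGroup.ker_le_commutator [Finite G] (h : IsGCStarGroup G)
    (ρ : Representation ℂ G V) [ρ.IsIrreducible] (hρ : finrank ℂ V ≠ 1) :
    MonoidHom.ker ρ ≤ commutator G := by
  intro g hg
  by_contra hgG
  obtain ⟨ν, hν⟩ := exists_monoidHom_apply_ne_one ℂ hgG
  have := nontrivial_of_isIrreducible ρ
  have hdeg : ρ.character g = finrank ℂ V := by
    rw [Representation.character, MonoidHom.mem_ker.1 hg, LinearMap.trace_one]
  have hchar : (twist ρ ν).character g = (twist ρ ν).character 1 :=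
    (h.galoisConjugate ρ (twist ρ ν) hρ rfl).eq_of_eq (hdeg.trans ρ.char_one.symm)
  rw [Representation.char_one, character_twist, hdeg] at hchar
  exact hν ((mul_eq_right₀ (Nat.cast_ne_zero.2 finrank_pos.ne')).1 hchar)

theorem IsGCStarGroup.apply_eq_one (h : IsGCStarGroup G) (ρ : Representation ℂ G V)
    [ρ.IsIrreducible] (τ : Representation ℂ G W) [τ.IsIrreducible] (hρ : finrank ℂ V ≠ 1)
    (hτ : finrank ℂ V = finrank ℂ W) {z : G} (hz : z ∈ center G) (hzρ : ρ z = 1) : τ z = 1 := by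
  rw [← character_eq_finrank_iff τ (center_le_repCenter τ hz), ← τ.char_one]
  refine (h.galoisConjugate ρ τ hρ hτ).eq_of_eq ?_
  rw [ρ.char_one, character_eq_finrank_iff ρ (center_le_repCenter ρ hz), hzρ]

variable [Finite G] {p : ℕ} [hp : Fact p.Prime]

theorem IsGCStarGroup.isCyclic_center (h : IsGCStarGroup G) (hc : Nat.card (commutator G) = p) :
    IsCyclic (center G) := by
  have hne : ¬ commutator G ≤ ⊥ := fun hbot ↦
    hp.out.ne_one (by rw [← hc, le_bot_iff.1 hbot, card_bot])
  obtain ⟨d, ρ, _, -, hρ⟩ := exists_isIrreducible_not_commutator_le_ker ℂ hne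
  have hker : MonoidHom.ker ρ = ⊥ := by
    by_contra hbot
    have hle := h.ker_le_commutator ρ (mt (finrank_eq_one_iff_commutator_le_ker ρ).1 hρ)
    obtain ⟨z, hz, hz1⟩ := (MonoidHom.ker ρ).bot_or_exists_ne_one.resolve_left hbot
    exact hρ (le_of_prime_card (hc ▸ hp.out) (hle hz) hz hz1)
  exact isCyclic_of_injective_ringHom _ (centralCharacter_comp_inclusion_injective ρ hker)

theorem IsGCStarGroup.relIndex_commutator_ne (h : IsGCStarGroup G) (hG : IsPGroup p G)
    {K : Subgroup G} (hK : K ≤ commutator G ⊓ center G) (hKp : Nat.card K = p) :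
    K.relIndex (commutator G) ≠ p := by
  intro hKG
  have hKG' : K ≤ commutator G := hK.trans inf_le_left
  have hKZ : K ≤ center G := hK.trans inf_le_right
  have hKnormal : K.Normal := normal_of_le_center hKZ
  have hKne : ¬ commutator G ≤ K := fun hle ↦
    hp.out.ne_one (hKG.symm.trans (relIndex_eq_one.2 hle))
  obtain ⟨d, ψ, _, hKψ, hψ⟩ := exists_isIrreducible_not_commutator_le_ker ℂ hKne
  have hψ1 := mt (finrank_eq_one_iff_commutator_le_ker ψ).1 hψ
  have hψle := h.ker_le_commutator ψ hψ1
  have hψK : MonoidHom.ker ψ = K := le_antisymm (fun g hg ↦ by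
    by_contra hgK
    exact hψ (le_of_relIndex_prime hKG' hKψ (hKG ▸ hp.out) (hψle hg) hg hgK)) hKψ
  have hKbot : K ≠ ⊥ := fun hbot ↦ hp.out.ne_one (by rw [← hKp, hbot, card_bot])
  obtain ⟨z, hz, hz1⟩ := K.bot_or_exists_ne_one.resolve_left hKbot
  obtain ⟨e, χ, _, hχz⟩ := exists_isIrreducible_apply_ne_one ℂ hz1
  have hχ1 := mt (finrank_eq_one_iff_commutator_le_ker χ).1 fun hle ↦ hχz (hle (hKG' hz))
  have hdeg := finrank_eq_finrank_of_not_ker_le_ker hG ψ χ (hψK ▸ hKp) (hψK ▸ hKG) hψle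
    (h.ker_le_commutator χ hχ1) fun hle ↦ hχz (hle (hKψ hz))
  exact hχz (h.apply_eq_one ψ χ hψ1 hdeg (hKZ hz) (hKψ hz))

theorem IsGCStarGroup.card_commutator (h : IsGCStarGroup G) (hG : IsPGroup p G)
    (hne : commutator G ≠ ⊥) : Nat.card (commutator G) = p := by
  induction hn : Nat.card G using Nat.strong_induction_on generalizing G with
  | _ n ih =>
    obtain ⟨K, hK, hKp⟩ := exists_le_inf_center_card_eq hG hne
    have hKnormal : K.Normal := normal_of_le_center (hK.trans inf_le_right)
    have hquot := card_commutator_quotient K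
    by_cases hKG : commutator (G ⧸ K) = ⊥
    · rw [hKG, card_bot] at hquot
      rw [← hKp, le_antisymm (relIndex_eq_one.1 hquot.symm) (hK.trans inf_le_left)]
    · have hlt : Nat.card (G ⧸ K) < n := by
        rw [← hn, card_eq_card_quotient_mul_card_subgroup K, hKp]
        exact lt_mul_of_one_lt_right Nat.card_pos hp.out.one_lt
      exact absurd (hquot.symm.trans (ih _ hlt
        (h.of_surjective (QuotientGroup.mk'_surjective K)) (hG.to_quotient K) hKG rfl))
        (h.relIndex_commutator_ne hG hK hKp)

theorem isGCStarGroup_of_isCyclic_center (hG : IsPGroup p G) [IsCyclic (center G)]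
    (hc : Nat.card (commutator G) = p) : IsGCStarGroup G := by
  rintro _ _ ⟨d, ρ, _, rfl⟩ ⟨e, τ, _, rfl⟩ hρ hτ -
  have hker {m : ℕ} (ρ : Representation ℂ G (Fin m → ℂ)) [ρ.IsIrreducible]
      (hρ : ρ.character 1 ≠ 1) : MonoidHom.ker ρ = ⊥ := by
    refine ker_eq_bot_of_finrank_ne_one hG hc ρ fun h ↦ hρ ?_
    rw [ρ.char_one, h, Nat.cast_one]
  exact galoisConjugate_of_ker_eq_bot (le_center_of_card_eq hG hc) ρ τ (hker ρ hρ) (hker τ hτ)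

end GCStar

theorem theorem3p1 (p : ℕ) (hp : p.Prime) (P : Type*) [Group P] [Finite P]
    (hP : IsPGroup p P) (hna : ¬ ∀ a b : P, a * b = b * a) :
    IsGCStarGroup P ↔
      IsCyclic (Subgroup.center P) ∧ Nat.card (commutator P) = p := by
  have : Fact p.Prime := ⟨hp⟩
  have hne : commutator P ≠ ⊥ := fun h ↦ hna fun a b ↦ commutatorElement_eq_one_iff_mul_comm.1 <|
    mem_bot.1 (h ▸ commutator_mem_commutator (mem_top a) (mem_top b))
  constructor
  · intro h
    have hcard := h.card_commutator hP hne
    exact ⟨h.isCyclic_center hcard, hcard⟩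
  · rintro ⟨_, hcard⟩
    exact isGCStarGroup_of_isCyclic_center hP hcard
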